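/- Let $C$ be a field of characteristic zero, and let $\sigma_x,\sigma_y$ be the automorphisms of $C(x,y)$ with $\sigma_x f(x,y)=f(x+1,y)$ and $\sigma_y f(x,y)=f(x,y+1)$. Let $D$ be a partial difference ring extension of $C(x,y)$: a ring containing $C(x,y)$ with two commuting injective endomorphisms extending $\sigma_x,\sigma_y$ (and denoted by the same letters). A nonzero $T\in D$ is a hypergeometric term if $\sigma_x(T)=fT$ and $\sigma_y(T)=gT$ for some $f,g\in C(x,y)$. Put $\Delta_y=\sigma_y-1$; $T$ is summable with respect to $y$ if $T=\Delta_y(G)$ for some hypergeometric term $G$. A telescoper for $T$ of order $\rho$ is an operator $L=e_0+e_1S_x+\dots+e_\rho S_x^\rho$ with $e_i\in C(x)$, $e_\rho\neq 0$, such that $L(T)=\sum_i e_i\sigma_x^i(T)=\Delta_y(G)$ for some hypergeometric term $G$. Let $T=SH$ be a hypergeometric term, where $S\in C(x,y)$ and $H$ is a hypergeometric term with $\sigma_y(H)=KH$, such that $K\in C(x,y)$ is nonzero and shift-reduced with respect to $y$ (as a rational function in $y$ over $C(x)$, its numerator is coprime with $\sigma_y^n$ of its denominator for all $n\in\mathbb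 Z$). Write $K=u/v$ with coprime $u,v\in C(x)[y]$. Let $\mathbb W_K$ be the $C(x)$-span of all powers $y^\ell$, $\ell\in\mathbb N$, such that $\ell$ is not the $y$-degree of any nonzero polynomial of the form $u\,\sigma_y(p)-v\,p$ with $p\in C(x)[y]$. Suppose that $$T=\Delta_y(gH)+\Bigl(\frac ab+\frac qv\Bigr)H,$$ where $g\in C(x,y)$; $a,b\in C(x)[y]$, $b\ne 0$, $\deg_y a<\deg_y b$, $\gcd(a,b)=1$; $b$ is shift-free with respect to $y$ (no two distinct roots of $b$ in an algebraic closure of $C(x)$ differ by an integer) and strongly prime with $K$ (that is, $\gcd(b,\sigma_y^{-i}u)=\gcd(b,\sigma_y^{i}v)=1$ for all $i\ge 0$); and $q\in\mathbb W_K$. Assume that $b$ is integer-linear over $C$: every irreducible factor in $C[x,y]$ of its numerator and of its denominator (as an element of $C(x,y)$ in lowest terms) has the form $P(\lambda x+\mu y)$ with $P\in C[z]$ and $\lambda,\mu\in\mathbb Z$. Finally assume that $T$ is not summable with respect to $y$. Then the order of every telescoper for $T$ is at least $$\max_{p}\ \min\bigl\{\rho\in\mathbb N\setminus\{0\} : \sigma_y^\ell(p)^\alpha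 \mid \sigma_x^\rho(b)\ \text{for some}\ \ell\in\mathbb Z\bigr\},$$ where $p$ runs over the monic irreducible factors of $b$ in $C(x)[y]$ with $\deg_y p>0$, $\alpha$ is the multiplicity of $p$ in $b$, and divisibility is in $C(x)[y]$. The sets whose minima are taken are nonempty. If $b$ has no such factor $p$, the maximum is read as $1$, the least element of $\mathbb N\setminus\{0\}$. -/

import Mathlib

open Polynomial

noncomputable section

namespace HypergeometricTelescoping

universe u v

section Univariate

variable {F : Type u} [Field F]

/-- The `n`-fold shift `σ_y ^ n` on `F[y]`, sending `p(y)` to `p(y + n)`, for an integer `n`. -/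
def polyShift (n : ℤ) : F[X] →+* F[X] :=
  (taylorAlgHom (n : F) : F[X] →ₐ[F] F[X]).toRingHom

/-- A ring homomorphism out of `F[y]` that is injective extends to the fraction fields. -/
def ratMap {E : Type v} [Field E] (f : F[X] →+* E[X]) (hf : Function.Injective f) :
    RatFunc F →+* RatFunc E :=
  RatFunc.mapRingHom f (nonZeroDivisors_le_comap_nonZeroDivisors_of_injective f hf)

theorem polyShift_injective (n : ℤ) : Function.Injective (polyShift (F := F) n) :=
  taylor_injective (n : F)

/-- The automorphism `r(y) ↦ r(y + 1)` of `F(y)`. -/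
def ratShift (F : Type u) [Field F] : RatFunc F →+* RatFunc F :=
  ratMap (polyShift 1) (polyShift_injective 1)

/-- A nonzero polynomial is shift-free if no two distinct roots (in an algebraic closure) differ
by an integer. -/
def ShiftFree (p : F[X]) : Prop :=
  p ≠ 0 ∧ ∀ r s : AlgebraicClosure F, aeval r p = 0 → aeval s p = 0 →
    ∀ n : ℤ, r - s = (n : AlgebraicClosure F) → r = s

/-- A nonzero rational function is shift-reduced if its numerator is coprime with every (integer)
shift of its denominator. -/
def ShiftReduced (K : RatFunc F) : Prop :=
  K ≠ 0 ∧ ∀ n : ℤ, IsCoprime K.num (polyShift n K.denom)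

/-- A nonzero polynomial `p` is strongly prime with `K = u / v` (in lowest terms) if
`gcd(p, σ_y^{-i} u) = gcd(p, σ_y^i v) = 1` for all `i ≥ 0`. -/
def StronglyPrime (u v p : F[X]) : Prop :=
  p ≠ 0 ∧ ∀ i : ℕ, IsCoprime p (polyShift (-(i : ℤ)) u) ∧ IsCoprime p (polyShift (i : ℤ) v)

/-- The image of the `F`-linear map `p ↦ u σ_y(p) - v p` for polynomial reduction w.r.t.
`K = u / v`. -/
def reductionImage (u v : F[X]) : Set F[X] :=
  Set.range fun p : F[X] => u * polyShift 1 p - v * p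

/-- The standard complement of the image of the map for polynomial reduction: the span of
the powers `y ^ ℓ` for which `ℓ` is not the degree of a nonzero element of the image. -/
def standardComplement (u v : F[X]) : Submodule F F[X] :=
  Submodule.span F {m : F[X] | ∃ l : ℕ, m = X ^ l ∧
    ∀ p ∈ reductionImage u v, p ≠ 0 → l ≠ p.natDegree}

end Univariate

section Bivariate

variable {C : Type u} [Field C]

/-- The shift `σ_x` on `C(x)[y]`, acting on the coefficients. -/
def polyShiftX (C : Type u) [Field C] : (RatFunc C)[X] →+* (RatFunc C)[X] :=
  Polynomial.mapRingHom (ratShift C)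

theorem polyShiftX_injective : Function.Injective (polyShiftX C) :=
  Polynomial.map_injective _ (ratShift C).injective

/-- The field `C(x, y)`, as the field of rational functions in `y` over `C(x)`. -/
abbrev RatXY (C : Type u) [Field C] : Type u := RatFunc (RatFunc C)

/-- `σ_x` on `C(x, y)`: the automorphism `f(x, y) ↦ f(x + 1, y)`. -/
def sigmaX (C : Type u) [Field C] : RatXY C →+* RatXY C :=
  ratMap (polyShiftX C) polyShiftX_injective

/-- `σ_y` on `C(x, y)`: the automorphism `f(x, y) ↦ f(x, y + 1)`. -/
def sigmaY (C : Type u) [Field C] : RatXY C →+* RatXY C :=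
  ratShift (RatFunc C)

/-- The inclusion of `C[x, y] = C[x][y]` into `C(x, y)`. -/
def ofPolyXY (C : Type u) [Field C] : C[X][X] →+* RatXY C :=
  (algebraMap (RatFunc C)[X] (RatXY C)).comp
    (Polynomial.mapRingHom (algebraMap C[X] (RatFunc C)))

/-- A polynomial in `C[x, y]` is integer-linear if each of its irreducible factors has the form
`P(l x + m y)` with `P` a univariate polynomial over `C` and `l`, `m` integers. -/
def IntegerLinearPoly (p : C[X][X]) : Prop :=
  ∀ q : C[X][X], Irreducible q → q ∣ p → ∃ (P : C[X]) (l m : ℤ),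
    q = aeval (l • Polynomial.C (X : C[X]) + m • (X : C[X][X])) P

/-- A rational function in `C(x, y)` is integer-linear if its numerator and denominator in
`C[x, y]` (in lowest terms) both are. -/
def IntegerLinear (f : RatXY C) : Prop :=
  ∃ p q : C[X][X], q ≠ 0 ∧ IsRelPrime p q ∧ f = ofPolyXY C p / ofPolyXY C q ∧
    IntegerLinearPoly p ∧ IntegerLinearPoly q

/-- A partial difference ring extension of `(C(x, y), {σ_x, σ_y})`: a ring `D` containing
`C(x, y)` (through the ring homomorphism `incl`), with two commuting injective endomorphisms
extending `σ_x` and `σ_y`. -/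
structure PartialDifferenceExtension (C : Type u) [Field C] (D : Type v) [Ring D] where
  /-- the inclusion of `C(x, y)` -/
  incl : RatXY C →+* D
  incl_injective : Function.Injective incl
  /-- the extension of `σ_x` -/
  shiftX : D →+* D
  /-- the extension of `σ_y` -/
  shiftY : D →+* D
  shiftX_injective : Function.Injective shiftX
  shiftY_injective : Function.Injective shiftY
  shift_comm : ∀ t, shiftX (shiftY t) = shiftY (shiftX t)
  shiftX_incl : ∀ f, shiftX (incl f) = incl (sigmaX C f)
  shiftY_incl : ∀ f, shiftY (incl f) = incl (sigmaY C f)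

/-- A nonzero operator `e_0 + e_1 S_x + ⋯ + e_ρ S_x ^ ρ` in `C(x)⟨S_x⟩`, where `ρ` is its order
(that is, `e_ρ ≠ 0`). -/
structure RecurrenceOperator (C : Type u) [Field C] where
  order : ℕ
  coeff : Fin (order + 1) → RatFunc C
  leading_ne_zero : coeff (Fin.last order) ≠ 0

namespace PartialDifferenceExtension

variable {D : Type v} [Ring D] (E : PartialDifferenceExtension C D)

/-- Hypergeometric terms over `C(x, y)` in the extension `D`. -/
def IsHypergeometric (T : D) : Prop :=
  T ≠ 0 ∧ (∃ f : RatXY C, E.shiftX T = E.incl f * T) ∧ ∃ g : RatXY C, E.shiftY T = E.incl g * T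

/-- The difference operator `Δ_y = σ_y - 1`. -/
def deltaY (G : D) : D := E.shiftY G - G

/-- Summability with respect to `y`: being the difference of a hypergeometric term. -/
def Summable (T : D) : Prop :=
  ∃ G : D, E.IsHypergeometric G ∧ T = E.deltaY G

/-- The application `L(T) = ∑ e_i σ_x^i(T)`. -/
def applyOp (L : RecurrenceOperator C) (T : D) : D :=
  ∑ i : Fin (L.order + 1), E.incl (RatFunc.C (L.coeff i)) * E.shiftX^[i] T

/-- `L` is a telescoper for `T` with respect to `y`: `L(T) = Δ_y(G)` for some hypergeometric
term `G`. -/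
def IsTelescoper (L : RecurrenceOperator C) (T : D) : Prop :=
  ∃ G : D, E.IsHypergeometric G ∧ E.applyOp L T = E.deltaY G

end PartialDifferenceExtension

/-- The set of all positive `ρ` such that some shift `σ_y^ℓ(p)^α`, `ℓ ∈ ℤ`, divides
`σ_x^ρ(b)`. -/
def shiftIndices (b p : (RatFunc C)[X]) (α : ℕ) : Set ℕ :=
  {ρ | ρ ≠ 0 ∧ ∃ l : ℤ, (polyShift l p) ^ α ∣ (polyShiftX C)^[ρ] b}

end Bivariate

end HypergeometricTelescoping

end

open HypergeometricTelescoping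

namespace HypergeometricTelescoping

/-! ### Integer shifts of polynomials and rational functions, and poles at a prime -/

section Univariate

variable {F : Type*} [Field F]

/-! Everything takes place in the coordinate f of a term f·H. There σ_y acts by τ(f) = K σ_y(f), σ_x
acts by θ(f) = N σ_x(f), and τ and θ commute. With r = a/b + q/v, a telescoper with coefficients e_i
says that f = ∑ e_i θ^i(r) equals τ(w) - w for some rational w; the part Δ_y(gH) is absorbed into w.
Since θ is bijective, e_0 ≠ 0 may be assumed.

Let p have multiplicity α in b, and suppose p^α divides no σ_y^n σ_x^i(b) with 1 ≤ i ≤ the order.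
For n ≠ 0 the pole of τ^n(f) at p then has order below α: the terms i ≥ 1 by assumption, the term i
= 0 because b is shift-free. Now τ^n(f) = τ^(n+1)(w) - τ^n(w), and τ^n(w) is regular at p for |n|
large. Coming in from both ends, τ(w) and w have poles of order below α, hence so has f
(`mem_poleSubgroup_of_eq_sub`). Removing the terms i ≥ 1 leaves e_0 r, whose pole has order at least
α: a contradiction.

It must also be checked that the multipliers hidden in τ^n θ^i create no pole at p. This follows
from strong primeness and shift-reducedness (`shiftFactor_mul_mem_localSubring`). Integer-linearity
serves only to make the minima exist (`shiftIndices_nonempty`). -/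

theorem polyShift_apply (n : ℤ) (p : F[X]) : polyShift n p = p.comp (X + C (n : F)) := rfl

theorem polyShift_polyShift (m n : ℤ) (p : F[X]) :
    polyShift m (polyShift n p) = polyShift (m + n) p := by
  simp [polyShift_apply, Polynomial.comp_assoc, add_assoc]

@[simp]
theorem polyShift_zero (p : F[X]) : polyShift 0 p = p := by
  simp [polyShift_apply]

theorem dvd_polyShift_iff (n : ℤ) (p q : F[X]) : p ∣ polyShift n q ↔ polyShift (-n) p ∣ q := by
  constructor
  · intro h
    simpa [polyShift_polyShift] using map_dvd (polyShift (F := F) (-n)) h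
  · intro h
    simpa [polyShift_polyShift] using map_dvd (polyShift (F := F) n) h

/-- A root r of `p` gives the root r + n of `t`, and in characteristic zero distinct n give distinct
roots. -/
theorem finite_setOf_dvd_polyShift [CharZero F] {p t : F[X]} (hp : 0 < p.degree) (ht : t ≠ 0) :
    {n : ℤ | p ∣ polyShift n t}.Finite := by
  obtain ⟨r, hr⟩ := IsAlgClosed.exists_aeval_eq_zero (AlgebraicClosure F) p hp.ne'
  have hfin : (t.rootSet (AlgebraicClosure F)).Finite := Polynomial.rootSet_finite _ _
  refine (hfin.preimage (f := fun n : ℤ => r + (n : AlgebraicClosure F)) ?_).subset ?_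
  · intro m _ n _ h
    simpa using h
  · rintro n ⟨c, hc⟩
    have h := congrArg (aeval r) hc
    rw [map_mul, hr, zero_mul, polyShift_apply, aeval_comp] at h
    simpa [Polynomial.mem_rootSet, ht] using h

theorem ShiftFree.not_dvd_polyShift [CharZero F] {b p : F[X]} (hb : ShiftFree b)
    (hp : 0 < p.degree) (hpb : p ∣ b) {n : ℤ} (hn : n ≠ 0) : ¬ p ∣ polyShift n b := by
  rintro ⟨c, hc⟩
  obtain ⟨r, hr⟩ := IsAlgClosed.exists_aeval_eq_zero (AlgebraicClosure F) p hp.ne'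
  have h := congrArg (aeval r) hc
  rw [map_mul, hr, zero_mul, polyShift_apply, aeval_comp] at h
  have h2 : aeval r b = 0 := by
    obtain ⟨d, rfl⟩ := hpb
    rw [map_mul, hr, zero_mul]
  have := hb.2 (r + n) r (by simpa using h) h2 n (by ring)
  simp_all

/-- The `n`-fold shift `r(y) ↦ r(y + n)` on `F(y)`, for an integer `n`. -/
noncomputable def ratShiftPow (n : ℤ) : RatFunc F →+* RatFunc F :=
  ratMap (polyShift n) (polyShift_injective n)

theorem ratMap_algebraMap {E : Type*} [Field E] (f : F[X] →+* E[X]) (hf : Function.Injective f)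
    (p : F[X]) : ratMap f hf (algebraMap F[X] (RatFunc F) p) = algebraMap E[X] (RatFunc E) (f p) := by
  have := RatFunc.map_apply_div f
    (nonZeroDivisors_le_comap_nonZeroDivisors_of_injective f hf) p 1
  simpa [ratMap, RatFunc.coe_mapRingHom_eq_coe_map] using this

theorem ratShiftPow_algebraMap (n : ℤ) (p : F[X]) :
    ratShiftPow n (algebraMap F[X] (RatFunc F) p) = algebraMap F[X] (RatFunc F) (polyShift n p) :=
  ratMap_algebraMap _ _ _

theorem exists_ratFunc_eq_div (f : RatFunc F) : ∃ s t : F[X], t ≠ 0 ∧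
    f = algebraMap F[X] (RatFunc F) s / algebraMap F[X] (RatFunc F) t :=
  ⟨f.num, f.denom, f.denom_ne_zero, (RatFunc.num_div_denom f).symm⟩

theorem ratFunc_ringHom_ext {E : Type*} [Semiring E] [Nontrivial E] {f g : RatFunc F →+* E}
    (h : ∀ p, f (algebraMap F[X] (RatFunc F) p) = g (algebraMap F[X] (RatFunc F) p)) : f = g :=
  IsLocalization.ringHom_ext (nonZeroDivisors F[X]) (RingHom.ext h)

theorem ratShiftPow_ratShiftPow (m n : ℤ) (f : RatFunc F) :
    ratShiftPow m (ratShiftPow n f) = ratShiftPow (m + n) f := by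
  have : (ratShiftPow m).comp (ratShiftPow n) = ratShiftPow (F := F) (m + n) :=
    ratFunc_ringHom_ext fun p => by simp [ratShiftPow_algebraMap, polyShift_polyShift]
  exact congrArg (fun φ => φ f) this

@[simp]
theorem ratShiftPow_zero (f : RatFunc F) : ratShiftPow 0 f = f := by
  have : ratShiftPow (F := F) 0 = RingHom.id _ :=
    ratFunc_ringHom_ext fun p => by simp [ratShiftPow_algebraMap]
  exact congrArg (fun φ => φ f) this

theorem ratShiftPow_C (n : ℤ) (c : F) : ratShiftPow n (RatFunc.C c) = RatFunc.C c := by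
  rw [← RatFunc.algebraMap_C, ratShiftPow_algebraMap]
  simp [polyShift_apply]

/-- The local ring of `F[y]` at a prime `p`, as a subring of `F(y)`. -/
def localSubring (p : F[X]) (hp : Prime p) : Subring (RatFunc F) where
  carrier := {f | ∃ s t : F[X], ¬ p ∣ t ∧
    f = algebraMap F[X] (RatFunc F) s / algebraMap F[X] (RatFunc F) t}
  mul_mem' := by
    rintro _ _ ⟨s, t, ht, rfl⟩ ⟨s', t', ht', rfl⟩
    exact ⟨s * s', t * t', fun h => (hp.dvd_or_dvd h).elim ht ht',
      by rw [map_mul, map_mul, div_mul_div_comm]⟩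
  one_mem' := ⟨1, 1, hp.not_dvd_one, by simp⟩
  add_mem' := by
    rintro _ _ ⟨s, t, ht, rfl⟩ ⟨s', t', ht', rfl⟩
    refine ⟨s * t' + t * s', t * t', fun h => (hp.dvd_or_dvd h).elim ht ht', ?_⟩
    rw [div_add_div]
    · simp
    · exact RatFunc.algebraMap_ne_zero (fun h => ht (h ▸ dvd_zero p))
    · exact RatFunc.algebraMap_ne_zero (fun h => ht' (h ▸ dvd_zero p))
  zero_mem' := ⟨0, 1, hp.not_dvd_one, by simp⟩
  neg_mem' := by
    rintro _ ⟨s, t, ht, rfl⟩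
    exact ⟨-s, t, ht, by rw [map_neg, neg_div]⟩

variable {p : F[X]} {hp : Prime p}

theorem div_mem_localSubring (s : F[X]) {t : F[X]} (ht : ¬ p ∣ t) :
    algebraMap F[X] (RatFunc F) s / algebraMap F[X] (RatFunc F) t ∈ localSubring p hp :=
  ⟨s, t, ht, rfl⟩

theorem algebraMap_mem_localSubring (s : F[X]) :
    algebraMap F[X] (RatFunc F) s ∈ localSubring p hp :=
  ⟨s, 1, hp.not_dvd_one, by simp⟩

theorem C_mem_localSubring (c : F) : RatFunc.C c ∈ localSubring p hp := by
  rw [← RatFunc.algebraMap_C]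
  exact algebraMap_mem_localSubring _

theorem Prime.degree_pos_of_polynomial (hp : Prime p) : 0 < p.degree :=
  degree_pos_of_ne_zero_of_nonunit hp.ne_zero hp.not_isUnit

/-- Only finitely many shifts of the denominator are divisible by `p`. This gives regularity far out
in both directions, where the propagation arguments start. -/
theorem finite_setOf_ratShiftPow_notMem [CharZero F] (w : RatFunc F) :
    {n : ℤ | ratShiftPow n w ∉ localSubring p hp}.Finite := by
  obtain ⟨s, t, ht, rfl⟩ := exists_ratFunc_eq_div w
  refine (finite_setOf_dvd_polyShift hp.degree_pos_of_polynomial ht).subset fun n hn => ?_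
  by_contra h
  exact hn (by
    rw [map_div₀, ratShiftPow_algebraMap, ratShiftPow_algebraMap]
    exact div_mem_localSubring _ h)

/-- The elements of `F(y)` whose pole at `p` has order at most `k`. -/
noncomputable def poleSubgroup (p : F[X]) (hp : Prime p) (k : ℕ) : AddSubgroup (RatFunc F) :=
  (localSubring p hp).toAddSubgroup.comap
    (AddMonoidHom.mulLeft (algebraMap F[X] (RatFunc F) p ^ k))

theorem mem_poleSubgroup {k : ℕ} {f : RatFunc F} : f ∈ poleSubgroup p hp k ↔
    algebraMap F[X] (RatFunc F) p ^ k * f ∈ localSubring p hp := Iff.rfl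

theorem mul_mem_poleSubgroup {k : ℕ} {f g : RatFunc F} (hf : f ∈ localSubring p hp)
    (hg : g ∈ poleSubgroup p hp k) : f * g ∈ poleSubgroup p hp k := by
  rw [mem_poleSubgroup] at *
  rw [mul_left_comm]
  exact mul_mem hf hg

theorem mem_poleSubgroup_of_mem {k : ℕ} {f : RatFunc F} (hf : f ∈ localSubring p hp) :
    f ∈ poleSubgroup p hp k :=
  mem_poleSubgroup.2 (mul_mem (pow_mem (algebraMap_mem_localSubring _) _) hf)

theorem div_mem_poleSubgroup (a : F[X]) {b : F[X]} {k : ℕ} (hb : b ≠ 0) (h : ¬ p ^ (k + 1) ∣ b) :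
    algebraMap F[X] (RatFunc F) a / algebraMap F[X] (RatFunc F) b ∈ poleSubgroup p hp k := by
  obtain ⟨n, c, hc, rfl⟩ := WfDvdMonoid.max_power_factor hb hp.irreducible
  have hn : n ≤ k := by
    by_contra! hkn
    exact h ((pow_dvd_pow p hkn).trans (dvd_mul_right _ _))
  have hp0 : algebraMap F[X] (RatFunc F) p ≠ 0 := RatFunc.algebraMap_ne_zero hp.ne_zero
  have hc0 : algebraMap F[X] (RatFunc F) c ≠ 0 :=
    RatFunc.algebraMap_ne_zero fun h => hc (h ▸ dvd_zero p)
  refine mem_poleSubgroup.2 ⟨p ^ (k - n) * a, c, hc, ?_⟩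
  obtain ⟨m, rfl⟩ := Nat.exists_eq_add_of_le hn
  simp only [map_mul, map_pow, add_tsub_cancel_left, pow_add]
  field_simp

theorem div_notMem_poleSubgroup {a b : F[X]} {k : ℕ} (hb : b ≠ 0) (hab : IsCoprime a b)
    (h : p ^ (k + 1) ∣ b) :
    algebraMap F[X] (RatFunc F) a / algebraMap F[X] (RatFunc F) b ∉ poleSubgroup p hp k := by
  rintro ⟨s, t, ht, hst⟩
  have ht0 : t ≠ 0 := fun h => ht (h ▸ dvd_zero p)
  obtain ⟨c, rfl⟩ := h
  have h1 : p ^ k * a * t = s * (p ^ (k + 1) * c) := by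
    apply RatFunc.algebraMap_injective F
    have hb' := RatFunc.algebraMap_ne_zero hb
    have ht' := RatFunc.algebraMap_ne_zero ht0
    simp only [AddMonoidHom.coe_mulLeft] at hst
    rw [← mul_div_assoc, div_eq_div_iff hb' ht'] at hst
    simpa using hst
  have h2 : a * t = s * (p * c) := by
    apply mul_left_cancel₀ (pow_ne_zero k hp.ne_zero)
    rw [← mul_assoc, h1]; ring
  have h3 : p ∣ a * t := ⟨s * c, by rw [h2]; ring⟩
  rcases hp.dvd_or_dvd h3 with h4 | h4
  · exact hp.not_isUnit (hab.isUnit_of_dvd' h4 (Dvd.intro_left (p ^ k * c) (by ring)))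
  · exact ht h4

end Univariate

end HypergeometricTelescoping

/-! ### The orbit of τ : w ↦ K σ_y(w) and its poles at a prime -/

namespace HypergeometricTelescoping

/-- A failure at n would propagate to n + 1, n + 2, …, giving infinitely many. -/
theorem Int.forall_ge_of_finite {P : ℤ → Prop} (hP : {n | ¬ P n}.Finite) {b : ℤ}
    (h : ∀ n, b ≤ n → P (n + 1) → P n) : ∀ n, b ≤ n → P n := by
  intro n hn
  by_contra hPn
  have key : ∀ k : ℕ, ¬ P (n + k) := by
    intro k
    induction k with
    | zero => simpa using hPn
    | succ k ih =>
      intro hk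
      exact ih (h _ (by omega) (by simpa [add_assoc] using hk))
  refine Set.infinite_of_injective_forall_mem (f := fun k : ℕ => n + (k : ℤ)) ?_ key hP
  intro a b hab
  simpa using hab

theorem Int.forall_le_of_finite {P : ℤ → Prop} (hP : {n | ¬ P n}.Finite) {b : ℤ}
    (h : ∀ n, n < b → P n → P (n + 1)) : ∀ n, n ≤ b → P n := by
  intro n hn
  have hP' : {n | ¬ P (-n)}.Finite := hP.preimage neg_injective.injOn
  have := Int.forall_ge_of_finite (P := fun n => P (-n)) hP' (b := -b)
    (fun m hm hPm => by simpa using h _ (by omega) hPm) (-n) (by omega)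
  simpa using this

section Dynamics

variable {F : Type*} [Field F]

/-- The factor `κ_n` in the formula `τ^n(w) = κ_n σ_y^n(w)` for the iterates, `n ∈ ℤ`, of the map
`τ : w ↦ K σ_y(w)`. -/
noncomputable def shiftFactor (K : RatFunc F) : ℤ → RatFunc F
  | Int.ofNat m => ∏ j ∈ Finset.range m, ratShiftPow (j : ℤ) K
  | Int.negSucc m => ∏ j ∈ Finset.range (m + 1), (ratShiftPow (-((j + 1 : ℕ) : ℤ)) K)⁻¹

@[simp]
theorem shiftFactor_zero (K : RatFunc F) : shiftFactor K 0 = 1 := by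
  change shiftFactor K (Int.ofNat 0) = 1
  simp [shiftFactor]

theorem shiftFactor_add_one {K : RatFunc F} (hK : K ≠ 0) (n : ℤ) :
    shiftFactor K (n + 1) = shiftFactor K n * ratShiftPow n K := by
  have h0 : ∀ m, ratShiftPow m K ≠ 0 := fun m => by simpa using hK
  match n with
  | Int.ofNat m => exact Finset.prod_range_succ _ _
  | Int.negSucc 0 =>
    change shiftFactor K 0 = _
    have := h0 (-1)
    simp [shiftFactor, Int.negSucc_eq, this]
  | Int.negSucc (m + 1) =>
    change shiftFactor K (Int.negSucc m) = _
    simp only [shiftFactor]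
    rw [Finset.prod_range_succ _ (m + 1), mul_assoc, Int.negSucc_eq]
    have := h0 (-((m + 1 + 1 : ℕ) : ℤ))
    push_cast at this ⊢
    rw [inv_mul_cancel₀ this, mul_one]

variable {p : F[X]} {hp : Prime p}

theorem shiftFactor_mem_localSubring {K : RatFunc F}
    (h : ∀ j : ℕ, ratShiftPow (j : ℤ) K ∈ localSubring p hp)
    (h' : ∀ j : ℕ, (ratShiftPow (-(j : ℤ)) K)⁻¹ ∈ localSubring p hp) (n : ℤ) :
    shiftFactor K n ∈ localSubring p hp := by
  match n with
  | Int.ofNat m => exact prod_mem fun j _ => h j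
  | Int.negSucc m => exact prod_mem fun j _ => h' (j + 1)

/-- The denominators in κ_n are shifts σ_y^j(v) with j ≥ 0 when n ≥ 0, and σ_y^(-j)(u) with j > 0
when n < 0; strong primeness keeps `p` out of both. -/
theorem StronglyPrime.shiftFactor_mem_localSubring {u v b : F[X]} (h : StronglyPrime u v b)
    (hpb : p ∣ b) (n : ℤ) :
    shiftFactor (algebraMap F[X] (RatFunc F) u / algebraMap F[X] (RatFunc F) v) n ∈
      localSubring p hp := by
  refine HypergeometricTelescoping.shiftFactor_mem_localSubring (fun j => ?_) (fun j => ?_) n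
  · rw [map_div₀, ratShiftPow_algebraMap, ratShiftPow_algebraMap]
    exact div_mem_localSubring _ fun hd => hp.not_isUnit ((h.2 j).2.isUnit_of_dvd' hpb hd)
  · rw [map_div₀, ratShiftPow_algebraMap, ratShiftPow_algebraMap, inv_div]
    exact div_mem_localSubring _ fun hd => hp.not_isUnit ((h.2 j).1.isUnit_of_dvd' hpb hd)

/-- If the iterates `τ^n(f)`, `n ≠ 0`, of an element `f = τ(w) - w` of the image of `τ - 1` have
poles of bounded order at `p`, then so has `f`. -/
theorem mem_poleSubgroup_of_eq_sub [CharZero F] {K w f : RatFunc F} (hK : K ≠ 0) {k : ℕ}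
    (hκ : ∀ n, shiftFactor K n ∈ localSubring p hp) (hf : f = K * ratShiftPow 1 w - w)
    (h : ∀ n, n ≠ 0 → shiftFactor K n * ratShiftPow n f ∈ poleSubgroup p hp k) :
    f ∈ poleSubgroup p hp k := by
  set P : ℤ → RatFunc F := fun n => shiftFactor K n * ratShiftPow n w with hP
  have hstep : ∀ n, shiftFactor K n * ratShiftPow n f = P (n + 1) - P n := by
    intro n
    simp only [hP, hf, map_sub, map_mul, ratShiftPow_ratShiftPow, shiftFactor_add_one hK]
    ring
  have hfin : {n | ¬ P n ∈ poleSubgroup p hp k}.Finite := by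
    refine (finite_setOf_ratShiftPow_notMem (hp := hp) w).subset fun n hn hw => ?_
    exact hn (mul_mem_poleSubgroup (hκ n) (mem_poleSubgroup_of_mem hw))
  -- The excluded index 0 is never crossed: the descent from +∞ stops at 1, the climb from -∞ stops
  -- at 0, and f = P 1 - P 0.
  have hge := Int.forall_ge_of_finite hfin (b := 1) (fun n hn hPn => by
    have := sub_mem hPn (hstep n ▸ h n (by omega))
    simpa using this) 1 le_rfl
  have hle := Int.forall_le_of_finite hfin (b := 0) (fun n hn hPn => by
    have := add_mem (hstep n ▸ h n (by omega)) hPn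
    simpa using this) 0 le_rfl
  have hf0 : f = P (0 + 1) - P 0 := by simpa using hstep 0
  rw [hf0]
  exact sub_mem hge hle

variable {K K' N : RatFunc F} {u' v' : F[X]}

theorem shiftFactor_add_one_mul (hK : K ≠ 0) (hN : K' * N = K * ratShiftPow 1 N) (n : ℤ) :
    shiftFactor K (n + 1) * ratShiftPow (n + 1) N =
      shiftFactor K n * ratShiftPow n N * ratShiftPow n K' := by
  rw [shiftFactor_add_one hK, ← ratShiftPow_ratShiftPow n 1, mul_assoc, ← map_mul, ← hN, map_mul]
  ring

/-- The elements D_n = κ_n σ_y^n(N) satisfy D_(n+1) = D_n σ_y^n(K') and are regular for all but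
finitely many n. If `p` divides no shift of `v'`, regularity passes upwards from -∞; if it divides
no shift of `u'`, downwards from +∞. In the application K' = σ_x^i(K). -/
theorem shiftFactor_mul_mem_localSubring [CharZero F] (hK : K ≠ 0)
    (hN : K' * N = K * ratShiftPow 1 N) (hκ : ∀ n, shiftFactor K n ∈ localSubring p hp)
    (hK' : K' = algebraMap F[X] (RatFunc F) u' / algebraMap F[X] (RatFunc F) v')
    (hu' : u' ≠ 0) (hv' : v' ≠ 0)
    (h : (∀ n, ¬ p ∣ polyShift n v') ∨ ∀ n, ¬ p ∣ polyShift n u') (n : ℤ) :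
    shiftFactor K n * ratShiftPow n N ∈ localSubring p hp := by
  have hfin : {n | ¬ shiftFactor K n * ratShiftPow n N ∈ localSubring p hp}.Finite :=
    (finite_setOf_ratShiftPow_notMem (hp := hp) N).subset fun n hn hN => hn (mul_mem (hκ n) hN)
  have hn0 : ∀ n, ratShiftPow n K' ≠ 0 := fun n => by
    simp [hK', RatFunc.algebraMap_ne_zero hu', RatFunc.algebraMap_ne_zero hv']
  rcases h with h | h
  · refine Int.forall_le_of_finite hfin (b := n) (fun m _ hm => ?_) n le_rfl
    rw [shiftFactor_add_one_mul hK hN, hK', map_div₀, ratShiftPow_algebraMap,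
      ratShiftPow_algebraMap]
    exact mul_mem hm (div_mem_localSubring _ (h m))
  · refine Int.forall_ge_of_finite hfin (b := n) (fun m _ hm => ?_) n le_rfl
    rw [shiftFactor_add_one_mul hK hN] at hm
    rw [← mul_inv_cancel_right₀ (hn0 m) (shiftFactor K m * _)]
    refine mul_mem hm ?_
    rw [hK', map_div₀, ratShiftPow_algebraMap, ratShiftPow_algebraMap, inv_div]
    exact div_mem_localSubring _ (h m)

/-- If `p` may divide a shift of `v'`, write q/v' = K' (q/u'): the factor K' turns D_n into D_(n+1),
and only the harmless denominator `u'` is left. -/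
theorem shiftFactor_mul_div_mem_localSubring [CharZero F] (hK : K ≠ 0)
    (hN : K' * N = K * ratShiftPow 1 N) (hκ : ∀ n, shiftFactor K n ∈ localSubring p hp)
    (hK' : K' = algebraMap F[X] (RatFunc F) u' / algebraMap F[X] (RatFunc F) v')
    (hu' : u' ≠ 0) (hv' : v' ≠ 0)
    (h : (∀ n, ¬ p ∣ polyShift n v') ∨ ∀ n, ¬ p ∣ polyShift n u') (q : F[X]) (n : ℤ) :
    shiftFactor K n * ratShiftPow n N *
      ratShiftPow n (algebraMap F[X] (RatFunc F) q / algebraMap F[X] (RatFunc F) v') ∈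
        localSubring p hp := by
  have hD := shiftFactor_mul_mem_localSubring hK hN hκ hK' hu' hv' h
  rcases h with h | h
  · rw [map_div₀, ratShiftPow_algebraMap, ratShiftPow_algebraMap]
    exact mul_mem (hD n) (div_mem_localSubring _ (h n))
  · have hq : algebraMap F[X] (RatFunc F) q / algebraMap F[X] (RatFunc F) v' =
        K' * (algebraMap F[X] (RatFunc F) q / algebraMap F[X] (RatFunc F) u') := by
      have := RatFunc.algebraMap_ne_zero hu'
      have := RatFunc.algebraMap_ne_zero hv'
      rw [hK']
      field_simp
    rw [hq, map_mul, ← mul_assoc, ← shiftFactor_add_one_mul hK hN, map_div₀,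
      ratShiftPow_algebraMap, ratShiftPow_algebraMap]
    exact mul_mem (hD _) (div_mem_localSubring _ (h n))

theorem isCoprime_polyShift_of_shiftReduced {K : RatFunc F} (hred : ShiftReduced K) {u v : F[X]}
    (hv : v ≠ 0) (huv : IsCoprime u v)
    (hKuv : K = algebraMap F[X] (RatFunc F) u / algebraMap F[X] (RatFunc F) v) (n : ℤ) :
    IsCoprime u (polyShift n v) := by
  have h1 : u * K.denom = K.num * v := by
    apply RatFunc.algebraMap_injective F
    have h2 := (RatFunc.num_div_denom K).trans hKuv
    rw [div_eq_div_iff (RatFunc.algebraMap_ne_zero K.denom_ne_zero)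
      (RatFunc.algebraMap_ne_zero hv)] at h2
    rw [map_mul, map_mul, h2]
  have hu : u ∣ K.num := huv.dvd_of_dvd_mul_right ⟨_, h1.symm⟩
  have hvd : v ∣ K.denom := huv.symm.dvd_of_dvd_mul_left ⟨K.num, by rw [h1, mul_comm]⟩
  have h3 := IsCoprime.of_isCoprime_of_dvd_left (hred.2 n) hu
  exact IsCoprime.of_isCoprime_of_dvd_right h3 (map_dvd (polyShift n) hvd)

theorem forall_not_dvd_polyShift_or {u v : F[X]} (h : ∀ n, IsCoprime u (polyShift n v))
    (hp : Prime p) : (∀ n, ¬ p ∣ polyShift n v) ∨ ∀ n, ¬ p ∣ polyShift n u := by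
  by_contra! hcon
  obtain ⟨⟨n, hn⟩, m, hm⟩ := hcon
  have := (h (n - m)).map (polyShift m)
  rw [polyShift_polyShift, add_sub_cancel] at this
  exact hp.not_isUnit (this.isUnit_of_dvd' hm hn)

end Dynamics

end HypergeometricTelescoping

/-! ### Twisted actions of σ_x and Δ_y on coordinates, and the pole argument -/

namespace HypergeometricTelescoping

section Bivariate

variable {C : Type*} [Field C]

theorem ratShift_surjective : Function.Surjective (ratShift C) := fun f =>
  ⟨ratShiftPow (-1) f, (ratShiftPow_ratShiftPow 1 (-1) f).trans (by simp)⟩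

theorem polyShiftX_surjective : Function.Surjective (polyShiftX C) :=
  Polynomial.map_surjective _ ratShift_surjective

theorem sigmaX_algebraMap (p : (RatFunc C)[X]) :
    sigmaX C (algebraMap (RatFunc C)[X] (RatXY C) p) =
      algebraMap (RatFunc C)[X] (RatXY C) (polyShiftX C p) :=
  ratMap_algebraMap _ _ _

theorem sigmaX_iterate_algebraMap (i : ℕ) (p : (RatFunc C)[X]) :
    (sigmaX C)^[i] (algebraMap (RatFunc C)[X] (RatXY C) p) =
      algebraMap (RatFunc C)[X] (RatXY C) ((polyShiftX C)^[i] p) := by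
  induction i with
  | zero => rfl
  | succ i ih => rw [Function.iterate_succ_apply', Function.iterate_succ_apply', ih,
      sigmaX_algebraMap]

theorem sigmaX_iterate_div (i : ℕ) (p q : (RatFunc C)[X]) :
    (sigmaX C)^[i]
      (algebraMap (RatFunc C)[X] (RatXY C) p / algebraMap (RatFunc C)[X] (RatXY C) q) =
      algebraMap (RatFunc C)[X] (RatXY C) ((polyShiftX C)^[i] p) /
        algebraMap (RatFunc C)[X] (RatXY C) ((polyShiftX C)^[i] q) := by
  rw [← sigmaX_iterate_algebraMap, ← sigmaX_iterate_algebraMap, ← RingHom.coe_pow, map_div₀]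

theorem sigmaX_surjective : Function.Surjective (sigmaX C) := by
  intro f
  obtain ⟨s, t, -, rfl⟩ := exists_ratFunc_eq_div f
  obtain ⟨s', rfl⟩ := polyShiftX_surjective s
  obtain ⟨t', rfl⟩ := polyShiftX_surjective t
  exact ⟨algebraMap (RatFunc C)[X] (RatXY C) s' / algebraMap (RatFunc C)[X] (RatXY C) t',
    by rw [map_div₀, sigmaX_algebraMap, sigmaX_algebraMap]⟩

theorem sigmaX_C (c : RatFunc C) : sigmaX C (RatFunc.C c) = RatFunc.C (ratShift C c) := by
  rw [← RatFunc.algebraMap_C, sigmaX_algebraMap]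
  simp [polyShiftX]

theorem polyShiftX_polyShift (n : ℤ) (p : (RatFunc C)[X]) :
    polyShiftX C (polyShift n p) = polyShift n (polyShiftX C p) := by
  simp [polyShift_apply, polyShiftX, Polynomial.map_comp]

theorem polyShiftX_iterate_polyShift (i : ℕ) (n : ℤ) (p : (RatFunc C)[X]) :
    (polyShiftX C)^[i] (polyShift n p) = polyShift n ((polyShiftX C)^[i] p) :=
  (Function.Commute.iterate_left (f := polyShiftX C) (g := polyShift n)
    (fun p => polyShiftX_polyShift n p) i) p

theorem sigmaX_ratShiftPow (n : ℤ) (f : RatXY C) :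
    sigmaX C (ratShiftPow n f) = ratShiftPow n (sigmaX C f) := by
  obtain ⟨s, t, -, rfl⟩ := exists_ratFunc_eq_div f
  simp only [map_div₀, sigmaX_algebraMap, ratShiftPow_algebraMap, polyShiftX_polyShift]

/-- The action `f ↦ N σ_x(f)` of `σ_x` on the coordinate of `f H`, if `σ_x(H) = N H`. -/
noncomputable def twistX (N f : RatXY C) : RatXY C := N * sigmaX C f

/-- The factor `N_i` in the formula `twistX^i(f) = N_i σ_x^i(f)`. -/
noncomputable def twistXFactor (N : RatXY C) : ℕ → RatXY C
  | 0 => 1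
  | i + 1 => N * sigmaX C (twistXFactor N i)

theorem twistX_iterate (N f : RatXY C) (i : ℕ) :
    (twistX N)^[i] f = twistXFactor N i * (sigmaX C)^[i] f := by
  induction i with
  | zero => simp [twistXFactor]
  | succ i ih =>
    rw [Function.iterate_succ_apply', Function.iterate_succ_apply', ih, twistX, twistXFactor,
      map_mul, mul_assoc]

theorem twistX_add (N f g : RatXY C) : twistX N (f + g) = twistX N f + twistX N g := by
  simp [twistX, mul_add]

theorem twistX_iterate_add (N f g : RatXY C) (i : ℕ) :
    (twistX N)^[i] (f + g) = (twistX N)^[i] f + (twistX N)^[i] g := by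
  induction i with
  | zero => rfl
  | succ i ih => simp only [Function.iterate_succ_apply', ih, twistX_add]

theorem twistX_injective {N : RatXY C} (hN : N ≠ 0) : Function.Injective (twistX N) :=
  (mul_right_injective₀ hN).comp (sigmaX C).injective

theorem twistX_surjective {N : RatXY C} (hN : N ≠ 0) : Function.Surjective (twistX N) := by
  intro f
  obtain ⟨g, hg⟩ := sigmaX_surjective (N⁻¹ * f)
  exact ⟨g, by rw [twistX, hg, mul_inv_cancel_left₀ hN]⟩

/-- The action `w ↦ K σ_y(w) - w` of `Δ_y` on the coordinate of `w H`, if `σ_y(H) = K H`. -/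
noncomputable def twistDelta (K w : RatXY C) : RatXY C := K * sigmaY C w - w

theorem sigmaY_C (c : RatFunc C) : sigmaY C (RatFunc.C c) = RatFunc.C c := ratShiftPow_C 1 c

theorem C_mul_twistDelta (c : RatFunc C) (K w : RatXY C) :
    RatFunc.C c * twistDelta K w = twistDelta K (RatFunc.C c * w) := by
  simp only [twistDelta, map_mul, sigmaY_C]
  ring

theorem twistDelta_sum {ι : Type*} (s : Finset ι) (K : RatXY C) (w : ι → RatXY C) :
    ∑ i ∈ s, twistDelta K (w i) = twistDelta K (∑ i ∈ s, w i) := by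
  simp only [twistDelta, Finset.sum_sub_distrib, ← Finset.mul_sum, map_sum]

theorem twistDelta_sub (K w z : RatXY C) :
    twistDelta K (w - z) = twistDelta K w - twistDelta K z := by
  simp only [twistDelta, map_sub]
  ring

variable {K N : RatXY C}

/-- The relation `hNK` is σ_x σ_y(H) = σ_y σ_x(H) read on coordinates. -/
theorem twistX_twistDelta (hNK : sigmaX C K * N = K * sigmaY C N) (w : RatXY C) :
    twistX N (twistDelta K w) = twistDelta K (twistX N w) := by
  have h : sigmaX C (sigmaY C w) = sigmaY C (sigmaX C w) := sigmaX_ratShiftPow 1 w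
  simp only [twistX, twistDelta, map_sub, map_mul, h]
  linear_combination (sigmaY C (sigmaX C w)) * hNK

theorem twistX_iterate_twistDelta (hNK : sigmaX C K * N = K * sigmaY C N) (w : RatXY C) (i : ℕ) :
    (twistX N)^[i] (twistDelta K w) = twistDelta K ((twistX N)^[i] w) :=
  (Function.Commute.iterate_left (f := twistX N) (g := twistDelta K)
    (fun w => twistX_twistDelta hNK w) i) w

theorem sigmaX_iterate_mul_twistXFactor (hNK : sigmaX C K * N = K * sigmaY C N) (i : ℕ) :
    (sigmaX C)^[i] K * twistXFactor N i = K * sigmaY C (twistXFactor N i) := by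
  induction i with
  | zero => simp [twistXFactor]
  | succ i ih =>
    have h : sigmaX C (sigmaY C (twistXFactor N i)) = sigmaY C (sigmaX C (twistXFactor N i)) :=
      sigmaX_ratShiftPow 1 _
    have h2 := congrArg (sigmaX C) ih
    rw [map_mul, map_mul, h] at h2
    rw [Function.iterate_succ_apply', twistXFactor, map_mul]
    linear_combination N * h2 + sigmaY C (sigmaX C (twistXFactor N i)) * hNK

variable [CharZero C]

variable {u v a b q p : (RatFunc C)[X]} {hp : Prime p}

/-- The multiplier κ_n σ_y^n(N_i) is regular at `p`, and stays so after multiplication by the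
shifted q/v, so a pole can only come from the shifted denominator `b`. -/
theorem iterate_twistX_mem_poleSubgroup (hK : K ≠ 0) (hNK : sigmaX C K * N = K * sigmaY C N)
    (hv : v ≠ 0) (hcop : ∀ n, IsCoprime u (polyShift n v))
    (hKuv : K = algebraMap (RatFunc C)[X] (RatXY C) u / algebraMap (RatFunc C)[X] (RatXY C) v)
    (hbprime : StronglyPrime u v b) (hpb : p ∣ b) {k i : ℕ} {n : ℤ}
    (hdvd : ¬ p ^ (k + 1) ∣ polyShift n ((polyShiftX C)^[i] b)) :
    shiftFactor K n * ratShiftPow n ((twistX N)^[i]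
      (algebraMap (RatFunc C)[X] (RatXY C) a / algebraMap (RatFunc C)[X] (RatXY C) b +
        algebraMap (RatFunc C)[X] (RatXY C) q / algebraMap (RatFunc C)[X] (RatXY C) v)) ∈
      poleSubgroup p hp k := by
  have hiter : ∀ f : (RatFunc C)[X], f ≠ 0 → (polyShiftX C)^[i] f ≠ 0 := fun f hf h =>
    hf ((polyShiftX_injective (C := C)).iterate i (h.trans
      (by rw [iterate_map_zero])))
  have hu : u ≠ 0 := by
    rintro rfl
    simp [hKuv] at hK
  have hκ : ∀ n, shiftFactor K n ∈ localSubring p hp := fun n => by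
    rw [hKuv]
    exact hbprime.shiftFactor_mem_localSubring hpb n
  have hN := sigmaX_iterate_mul_twistXFactor hNK i
  have hK' : (sigmaX C)^[i] K = algebraMap (RatFunc C)[X] (RatXY C) ((polyShiftX C)^[i] u) /
      algebraMap (RatFunc C)[X] (RatXY C) ((polyShiftX C)^[i] v) := by
    rw [hKuv, sigmaX_iterate_div]
  have hcop' : ∀ n, IsCoprime ((polyShiftX C)^[i] u) (polyShift n ((polyShiftX C)^[i] v)) := by
    intro n
    rw [← polyShiftX_iterate_polyShift, ← RingHom.coe_pow]
    exact (hcop n).map _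
  have hor := forall_not_dvd_polyShift_or hcop' hp
  have h1 := shiftFactor_mul_mem_localSubring hK hN hκ hK' (hiter u hu) (hiter v hv) hor n
  have h2 := shiftFactor_mul_div_mem_localSubring hK hN hκ hK' (hiter u hu) (hiter v hv) hor
    ((polyShiftX C)^[i] q) n
  rw [twistX_iterate, iterate_map_add, sigmaX_iterate_div, sigmaX_iterate_div, map_mul, map_add, ← mul_assoc, mul_add]
  refine add_mem (mul_mem_poleSubgroup h1 ?_) (mem_poleSubgroup_of_mem h2)
  rw [map_div₀, ratShiftPow_algebraMap, ratShiftPow_algebraMap]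
  refine div_mem_poleSubgroup _ ?_ hdvd
  simpa using (polyShift_injective n).ne (hiter b hbprime.1)

theorem exists_dvd_of_sum_eq_twistDelta_of_ne_zero (hK : K ≠ 0)
    (hNK : sigmaX C K * N = K * sigmaY C N)
    (hv : v ≠ 0) (hcop : ∀ n, IsCoprime u (polyShift n v))
    (hKuv : K = algebraMap (RatFunc C)[X] (RatXY C) u / algebraMap (RatFunc C)[X] (RatXY C) v)
    (hbprime : StronglyPrime u v b) (hbfree : ShiftFree b) (hab : IsCoprime a b)
    (hp : Prime p) {k : ℕ} (hpb : p ^ (k + 1) ∣ b) (d : ℕ) (e : ℕ → RatFunc C) (w : RatXY C)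
    (he : e 0 ≠ 0)
    (hsum : ∑ i ∈ Finset.range (d + 1), RatFunc.C (e i) * (twistX N)^[i]
      (algebraMap (RatFunc C)[X] (RatXY C) a / algebraMap (RatFunc C)[X] (RatXY C) b +
        algebraMap (RatFunc C)[X] (RatXY C) q / algebraMap (RatFunc C)[X] (RatXY C) v) =
      twistDelta K w) :
    ∃ i, i ≠ 0 ∧ i ≤ d ∧ ∃ n : ℤ, p ^ (k + 1) ∣ polyShift n ((polyShiftX C)^[i] b) := by
  have hpb1 : p ∣ b := (dvd_pow_self p k.succ_ne_zero).trans hpb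
  by_contra! hno
  set r := algebraMap (RatFunc C)[X] (RatXY C) a / algebraMap (RatFunc C)[X] (RatXY C) b +
    algebraMap (RatFunc C)[X] (RatXY C) q / algebraMap (RatFunc C)[X] (RatXY C) v with hr
  have hmem : ∀ i n, ¬ p ^ (k + 1) ∣ polyShift n ((polyShiftX C)^[i] b) →
      shiftFactor K n * ratShiftPow n ((twistX N)^[i] r) ∈ poleSubgroup p hp k := fun i n h =>
    iterate_twistX_mem_poleSubgroup hK hNK hv hcop hKuv hbprime hpb1 h
  have hκ : ∀ n, shiftFactor K n ∈ localSubring p hp := fun n => by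
    rw [hKuv]
    exact hbprime.shiftFactor_mem_localSubring hpb1 n
  have hall := mem_poleSubgroup_of_eq_sub (hp := hp) (k := k) hK hκ hsum (fun n hn => by
    rw [map_sum, Finset.mul_sum]
    refine sum_mem fun i hi => ?_
    rw [map_mul, ratShiftPow_C, mul_left_comm]
    refine mul_mem_poleSubgroup (C_mem_localSubring _) (hmem i n ?_)
    -- For i = 0 the index n is nonzero, and shift-freeness of `b` applies; for i ≥ 1 it is the
    -- assumption `hno`.
    rcases eq_or_ne i 0 with rfl | hi0
    · intro h
      exact hbfree.not_dvd_polyShift hp.degree_pos_of_polynomial hpb1 hn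
        ((dvd_pow_self p k.succ_ne_zero).trans h)
    · exact hno i hi0 (by simpa [Nat.lt_succ_iff] using hi) n)
  rw [Finset.sum_range_succ'] at hall
  have hrest : ∑ i ∈ Finset.range d, RatFunc.C (e (i + 1)) * (twistX N)^[i + 1] r ∈
      poleSubgroup p hp k := by
    refine sum_mem fun i hi => mul_mem_poleSubgroup (C_mem_localSubring _) ?_
    have := hmem (i + 1) 0 (hno (i + 1) i.succ_ne_zero
      (by simpa [Nat.succ_le_iff] using hi) 0)
    simpa using this
  have h0 := (AddSubgroup.add_mem_cancel_left _ hrest).1 hall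
  have h1 := mul_mem_poleSubgroup (hp := hp) (C_mem_localSubring (e 0)⁻¹) h0
  have hC : (RatFunc.C (e 0)⁻¹ * RatFunc.C (e 0) : RatXY C) = 1 := by
    rw [← map_mul, inv_mul_cancel₀ he, map_one]
  rw [← mul_assoc, hC, one_mul, Function.iterate_zero, id, hr] at h1
  have hpv : ¬ p ∣ v := fun hd => hp.not_isUnit
    (((hbprime.2 0).2).isUnit_of_dvd' hpb1 (by simpa using hd))
  have h2 := (AddSubgroup.add_mem_cancel_right _
    (mem_poleSubgroup_of_mem (div_mem_localSubring q hpv))).1 h1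
  exact div_notMem_poleSubgroup hbprime.1 hab hpb h2

/-- When e_0 = 0 the whole relation is θ of a relation with one term fewer, its coefficients pulled
back through σ_x. Cancelling θ only lowers the bound on i. -/
theorem exists_dvd_of_sum_eq_twistDelta (hK : K ≠ 0) (hN : N ≠ 0)
    (hNK : sigmaX C K * N = K * sigmaY C N)
    (hv : v ≠ 0) (hcop : ∀ n, IsCoprime u (polyShift n v))
    (hKuv : K = algebraMap (RatFunc C)[X] (RatXY C) u / algebraMap (RatFunc C)[X] (RatXY C) v)
    (hbprime : StronglyPrime u v b) (hbfree : ShiftFree b) (hab : IsCoprime a b)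
    (hp : Prime p) {k : ℕ} (hpb : p ^ (k + 1) ∣ b) (d : ℕ) (e : ℕ → RatFunc C) (w : RatXY C)
    (he : ∃ i ≤ d, e i ≠ 0)
    (hsum : ∑ i ∈ Finset.range (d + 1), RatFunc.C (e i) * (twistX N)^[i]
      (algebraMap (RatFunc C)[X] (RatXY C) a / algebraMap (RatFunc C)[X] (RatXY C) b +
        algebraMap (RatFunc C)[X] (RatXY C) q / algebraMap (RatFunc C)[X] (RatXY C) v) =
      twistDelta K w) :
    ∃ i, i ≠ 0 ∧ i ≤ d ∧ ∃ n : ℤ, p ^ (k + 1) ∣ polyShift n ((polyShiftX C)^[i] b) := by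
  induction d generalizing e w with
  | zero =>
    obtain ⟨i, hi, hei⟩ := he
    obtain rfl : i = 0 := by omega
    exact exists_dvd_of_sum_eq_twistDelta_of_ne_zero hK hNK hv hcop hKuv hbprime hbfree hab hp
      hpb 0 e w hei hsum
  | succ d ih =>
    rcases ne_or_eq (e 0) 0 with he0 | he0
    · exact exists_dvd_of_sum_eq_twistDelta_of_ne_zero hK hNK hv hcop hKuv hbprime hbfree hab
        hp hpb _ e w he0 hsum
    choose s hs using ratShift_surjective (C := C)
    obtain ⟨w', rfl⟩ := twistX_surjective hN w
    have he' : ∃ i ≤ d, s (e (i + 1)) ≠ 0 := by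
      obtain ⟨i, hi, hei⟩ := he
      obtain ⟨i, rfl⟩ := Nat.exists_eq_succ_of_ne_zero (n := i) (by rintro rfl; exact hei he0)
      refine ⟨i, by omega, fun h => hei ?_⟩
      rw [← hs (e i.succ), h, map_zero]
    obtain ⟨i, hi0, hid, hi⟩ := ih (fun i => s (e (i + 1))) w' he' (by
      apply twistX_injective hN
      rw [twistX_twistDelta hNK, ← hsum, Finset.sum_range_succ' _ (d + 1), he0, map_zero,
        zero_mul, add_zero, twistX, map_sum, Finset.mul_sum]
      refine Finset.sum_congr rfl fun i _ => ?_
      rw [map_mul, sigmaX_C, hs, Function.iterate_succ_apply', twistX, mul_left_comm])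
    exact ⟨i, hi0, by omega, hi⟩

end Bivariate

end HypergeometricTelescoping

/-! ### Integer-linear factors and existence of the minima -/

namespace HypergeometricTelescoping

section IntegerLinear

variable {C : Type*} [Field C]

/-- Clear denominators and divide by the content; both are units over `K`. This brings factors over
C(x) back to C[x, y], where integer-linearity is stated. -/
theorem exists_primitive_associated_map {R K : Type*} [CommRing R] [IsDomain R]
    [UniqueFactorizationMonoid R] [Field K] [Algebra R K] [IsFractionRing R K] {p : K[X]}
    (hp : p ≠ 0) : ∃ P : R[X], P.IsPrimitive ∧ Associated p (P.map (algebraMap R K)) := by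
  let : NormalizedGCDMonoid R := Classical.arbitrary _
  obtain ⟨c, c0, hc⟩ := IsLocalization.integerNormalization_spec (nonZeroDivisors R) p
  set I := IsLocalization.integerNormalization (nonZeroDivisors R) p with hI
  have hI0 : I ≠ 0 := by
    rwa [Ne, IsFractionRing.integerNormalization_eq_zero_iff]
  refine ⟨I.primPart, I.isPrimitive_primPart, ?_⟩
  have hinj := IsFractionRing.injective R K
  have h1 : IsUnit (C (algebraMap R K c)) := Polynomial.isUnit_C.2
    (isUnit_iff_ne_zero.2 ((map_ne_zero_iff _ hinj).2 (nonZeroDivisors.ne_zero c0)))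
  have h2 : IsUnit (C (algebraMap R K I.content)) := Polynomial.isUnit_C.2
    (isUnit_iff_ne_zero.2 ((map_ne_zero_iff _ hinj).2 (by rwa [Ne, content_eq_zero_iff])))
  rw [I.eq_C_content_mul_primPart, Polynomial.map_mul, map_C, Algebra.smul_def,
    Polynomial.algebraMap_apply] at hc
  exact ((associated_unit_mul_left p _ h1).symm.trans (hc ▸ Associated.refl _)).trans
    (associated_unit_mul_left _ _ h2)

/-- The polynomial `P(l x + m y + n)` as an element of `C(x)[y]`. -/
noncomputable def linearComp (P : C[X]) (l m n : ℤ) : (RatFunc C)[X] :=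
  eval₂ (Polynomial.C.comp RatFunc.C)
    (l • Polynomial.C (RatFunc.X : RatFunc C) + m • X + (n : (RatFunc C)[X])) P

theorem polyShift_linearComp (P : C[X]) (l m n k : ℤ) :
    polyShift k (linearComp P l m n) = linearComp P l m (n + k * m) := by
  rw [linearComp, hom_eval₂, linearComp]
  congr 1
  · ext c
    simp [polyShift_apply]
  · simp [polyShift_apply]
    ring

theorem ratShift_C (c : C) : ratShift C (RatFunc.C c) = RatFunc.C c :=
  ratShiftPow_C 1 c

theorem ratShift_X : ratShift C RatFunc.X = RatFunc.X + 1 := by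
  rw [← RatFunc.algebraMap_X]
  refine (ratShiftPow_algebraMap 1 X).trans ?_
  simp [polyShift_apply]

theorem polyShiftX_linearComp (P : C[X]) (l m n : ℤ) :
    polyShiftX C (linearComp P l m n) = linearComp P l m (n + l) := by
  rw [linearComp, hom_eval₂, linearComp]
  congr 1
  · ext c
    simp [polyShiftX, ratShift_C]
  · simp [polyShiftX, ratShift_X]
    ring

theorem polyShiftX_iterate_linearComp (P : C[X]) (l m n : ℤ) (i : ℕ) :
    (polyShiftX C)^[i] (linearComp P l m n) = linearComp P l m (n + i * l) := by
  induction i with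
  | zero => simp
  | succ i ih =>
    rw [Function.iterate_succ_apply', ih, polyShiftX_linearComp]
    congr 1
    push_cast
    ring

/-- By Gauss's lemma, the primitive representative of `p` is irreducible in C[x, y] and divides the
numerator of `b`. -/
theorem exists_associated_linearComp {b p : (RatFunc C)[X]}
    (hbint : IntegerLinear (algebraMap (RatFunc C)[X] (RatXY C) b)) (hp : Irreducible p)
    (hpb : p ∣ b) : ∃ (P : C[X]) (l m : ℤ), Associated p (linearComp P l m 0) := by
  obtain ⟨A, B, hB, -, hAB, hA, -⟩ := hbint
  have hmap : B.map (algebraMap C[X] (RatFunc C)) ≠ 0 :=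
    (Polynomial.map_ne_zero_iff (IsFractionRing.injective C[X] (RatFunc C))).2 hB
  have hbA : b * B.map (algebraMap C[X] (RatFunc C)) = A.map (algebraMap C[X] (RatFunc C)) := by
    apply RatFunc.algebraMap_injective (RatFunc C)
    rw [map_mul, hAB]
    exact div_mul_cancel₀ _ (RatFunc.algebraMap_ne_zero hmap)
  obtain ⟨Q, hQ, hpQ⟩ := exists_primitive_associated_map (R := C[X]) hp.ne_zero
  have hQirr : Irreducible Q := hQ.irreducible_of_irreducible_map_of_injective
    (IsFractionRing.injective C[X] (RatFunc C)) (hpQ.irreducible hp)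
  have hQA : Q ∣ A := hQ.dvd_of_fraction_map_dvd_fraction_map
    (hpQ.symm.dvd.trans (hpb.trans ⟨_, hbA.symm⟩))
  obtain ⟨P, l, m, rfl⟩ := hA Q hQirr hQA
  refine ⟨P, l, m, ?_⟩
  convert hpQ using 1
  rw [aeval_def, ← coe_mapRingHom, hom_eval₂, linearComp]
  congr 1
  · ext c
    simp
  · simp

theorem iterate_polyShiftX_dvd {p q : (RatFunc C)[X]} (h : p ∣ q) (i : ℕ) :
    (polyShiftX C)^[i] p ∣ (polyShiftX C)^[i] q := by
  obtain ⟨c, rfl⟩ := h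
  rw [iterate_map_mul]
  exact dvd_mul_right _ _

theorem shiftIndices_nonempty {b p : (RatFunc C)[X]}
    (hbint : IntegerLinear (algebraMap (RatFunc C)[X] (RatXY C) b)) (hp : Irreducible p)
    (hpdeg : 0 < p.natDegree) (hpb : p ∣ b) {α : ℕ} (hα : p ^ α ∣ b) :
    (shiftIndices b p α).Nonempty := by
  obtain ⟨P, l, m, h⟩ := exists_associated_linearComp hbint hp hpb
  have hm : m ≠ 0 := by
    rintro rfl
    have h1 : linearComp P l 0 0 =
        Polynomial.C (eval₂ RatFunc.C (l • RatFunc.X) P) := by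
      rw [hom_eval₂, linearComp]
      simp
    rw [natDegree_eq_of_degree_eq (degree_eq_degree_of_associated h), h1, natDegree_C] at hpdeg
    exact lt_irrefl _ hpdeg
  -- Replacing x by x + |m| adds l|m| = (l sign m) m to lx + my, which is also the effect of y ↦ y +
  -- l sign m.
  refine ⟨m.natAbs, Int.natAbs_ne_zero.2 hm, l * m.sign, ?_⟩
  have h2 : polyShift (l * m.sign) (linearComp P l m 0) =
      (polyShiftX C)^[m.natAbs] (linearComp P l m 0) := by
    rw [polyShift_linearComp, polyShiftX_iterate_linearComp, mul_assoc, Int.sign_mul_self_eq_abs,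
      Int.abs_eq_natAbs, mul_comm l]
  have h3 : polyShift (l * m.sign) p ∣ (polyShiftX C)^[m.natAbs] p := by
    refine (map_dvd (polyShift (l * m.sign)) h.dvd).trans ?_
    rw [h2]
    exact iterate_polyShiftX_dvd h.symm.dvd _
  refine (pow_dvd_pow_of_dvd h3 α).trans ?_
  rw [← iterate_map_pow]
  exact iterate_polyShiftX_dvd hα _

end IntegerLinear

/-! ### Passing from terms in `D` to coordinates -/

namespace PartialDifferenceExtension

variable {C : Type*} [Field C] {D : Type*} [Ring D] (E : PartialDifferenceExtension C D)

theorem incl_mul_eq_zero {f : RatXY C} {H : D} (hH : H ≠ 0) (h : E.incl f * H = 0) : f = 0 := by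
  by_contra hf
  apply hH
  rw [← one_mul H, ← map_one E.incl, ← inv_mul_cancel₀ hf, map_mul, mul_assoc, h, mul_zero]

theorem incl_mul_left_injective {f g : RatXY C} {H : D} (hH : H ≠ 0)
    (h : E.incl f * H = E.incl g * H) : f = g :=
  sub_eq_zero.1 (E.incl_mul_eq_zero hH (by rw [map_sub, sub_mul, h, sub_self]))

variable {E} {K N : RatXY C} {H : D}

theorem deltaY_incl_mul (hK : E.shiftY H = E.incl K * H) (w : RatXY C) :
    E.deltaY (E.incl w * H) = E.incl (twistDelta K w) * H := by
  rw [deltaY, twistDelta, map_mul, E.shiftY_incl, hK, map_sub, map_mul, sub_mul, ← mul_assoc,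
    ← map_mul, ← map_mul, mul_comm]

theorem shiftX_iterate_incl_mul (hN : E.shiftX H = E.incl N * H) (f : RatXY C) (i : ℕ) :
    E.shiftX^[i] (E.incl f * H) = E.incl ((twistX N)^[i] f) * H := by
  induction i with
  | zero => rfl
  | succ i ih =>
    rw [Function.iterate_succ_apply', ih, Function.iterate_succ_apply', map_mul, E.shiftX_incl,
      hN, ← mul_assoc, ← map_mul, twistX, mul_comm N]

theorem applyOp_incl_mul (hN : E.shiftX H = E.incl N * H) (L : RecurrenceOperator C)
    (f : RatXY C) : E.applyOp L (E.incl f * H) =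
      E.incl (∑ i : Fin (L.order + 1), RatFunc.C (L.coeff i) * (twistX N)^[i] f) * H := by
  rw [applyOp, map_sum, Finset.sum_mul]
  refine Finset.sum_congr rfl fun i _ => ?_
  rw [shiftX_iterate_incl_mul hN, ← mul_assoc, map_mul]

theorem IsHypergeometric.exists_twistX (hH : E.IsHypergeometric H)
    (hK : E.shiftY H = E.incl K * H) : ∃ N : RatXY C, N ≠ 0 ∧ E.shiftX H = E.incl N * H ∧
      sigmaX C K * N = K * sigmaY C N := by
  obtain ⟨hH0, ⟨N, hN⟩, -⟩ := hH
  refine ⟨N, ?_, hN, ?_⟩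
  · rintro rfl
    rw [map_zero, zero_mul] at hN
    exact hH0 (E.shiftX_injective (hN.trans (map_zero _).symm))
  · apply E.incl_mul_left_injective hH0
    have h := E.shift_comm H
    rw [hK, hN, map_mul, map_mul, E.shiftX_incl, E.shiftY_incl, hN, hK, ← mul_assoc, ← mul_assoc,
      ← map_mul, ← map_mul] at h
    rw [h, mul_comm]

/-- An element of `C(x, y) H` that is a difference of some hypergeometric term is a difference of
an element of `C(x, y) H`. -/
theorem IsHypergeometric.exists_twistDelta (hH : H ≠ 0) (hK : E.shiftY H = E.incl K * H) {G : D}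
    (hG : E.IsHypergeometric G) {f : RatXY C} (hf : E.incl f * H = E.deltaY G) :
    ∃ w, f = twistDelta K w := by
  obtain ⟨-, -, g, hg⟩ := hG
  have hd : E.deltaY G = E.incl (g - 1) * G := by
    rw [deltaY, hg, map_sub, map_one, sub_mul, one_mul]
  rcases eq_or_ne (g - 1) 0 with h0 | h0
  · refine ⟨0, ?_⟩
    rw [hd, h0, map_zero, zero_mul] at hf
    rw [E.incl_mul_eq_zero hH hf]
    simp [twistDelta]
  -- Since Δ_y(G) = (g - 1) G, the term G is itself a rational multiple of H, with this coordinate.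
  · refine ⟨(g - 1)⁻¹ * f, E.incl_mul_left_injective hH ?_⟩
    rw [← deltaY_incl_mul hK, map_mul, mul_assoc, hf, hd, ← mul_assoc, ← map_mul,
      inv_mul_cancel₀ h0, map_one, one_mul, ← hd]

theorem IsHypergeometric.incl_mul {G : D} (hG : E.IsHypergeometric G) {c : RatXY C} (hc : c ≠ 0) :
    E.IsHypergeometric (E.incl c * G) := by
  obtain ⟨h0, ⟨f, hf⟩, g, hg⟩ := hG
  refine ⟨fun h => hc (E.incl_mul_eq_zero h0 h), ⟨sigmaX C c * f * c⁻¹, ?_⟩,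
    sigmaY C c * g * c⁻¹, ?_⟩
  · rw [map_mul, E.shiftX_incl, hf, ← mul_assoc, ← mul_assoc, ← map_mul, ← map_mul,
      inv_mul_cancel_right₀ hc]
  · rw [map_mul, E.shiftY_incl, hg, ← mul_assoc, ← mul_assoc, ← map_mul, ← map_mul,
      inv_mul_cancel_right₀ hc]

/-- An operator of order 0 is a nonzero element of C(x), fixed by σ_y; dividing G by it would make T
summable. -/
theorem IsTelescoper.one_le_order {T : D} (hT : ¬ E.Summable T) {L : RecurrenceOperator C}
    (hL : E.IsTelescoper L T) : 1 ≤ L.order := by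
  obtain ⟨d, c, hc⟩ := L
  rcases d with _ | d
  · exfalso
    obtain ⟨G, hG, h⟩ := hL
    have hc0 : (RatFunc.C (c 0) : RatXY C) ≠ 0 := by simpa using hc
    apply hT
    refine ⟨E.incl (RatFunc.C (c 0))⁻¹ * G, hG.incl_mul (inv_ne_zero hc0), ?_⟩
    have h1 : E.incl (RatFunc.C (c 0)) * T = E.deltaY G := by
      simpa [applyOp] using h
    have h2 : E.deltaY (E.incl (RatFunc.C (c 0))⁻¹ * G) =
        E.incl (RatFunc.C (c 0))⁻¹ * E.deltaY G := by
      rw [deltaY, map_mul, E.shiftY_incl, map_inv₀, sigmaY_C, deltaY, mul_sub]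
    rw [h2, ← h1, ← mul_assoc, ← map_mul, inv_mul_cancel₀ hc0, map_one, one_mul]
  · exact Nat.succ_le_succ (Nat.zero_le d)

end PartialDifferenceExtension

end HypergeometricTelescoping

/-! ### The lower bound for the order -/

theorem mainTheorem2 {C : Type*} [Field C] [CharZero C] {D : Type*} [Ring D]
    (E : PartialDifferenceExtension C D)
    -- a hypergeometric term with multiplicative decomposition `T = S H`, kernel `K = u / v`
    (T H : D) (S K : RatXY C) (u v : (RatFunc C)[X])
    (hT : E.IsHypergeometric T) (hH : E.IsHypergeometric H)
    (hTSH : T = E.incl S * H)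
    (hHK : E.shiftY H = E.incl K * H) (hKred : ShiftReduced K)
    (hv : v ≠ 0) (huv : IsCoprime u v)
    (hKuv : K = algebraMap (RatFunc C)[X] (RatXY C) u / algebraMap (RatFunc C)[X] (RatXY C) v)
    -- the initial reduction of `T`, with significant denominator `b`
    (g : RatXY C) (a b q : (RatFunc C)[X])
    (hred : T = E.deltaY (E.incl g * H) +
      E.incl (algebraMap (RatFunc C)[X] (RatXY C) a / algebraMap (RatFunc C)[X] (RatXY C) b +
        algebraMap (RatFunc C)[X] (RatXY C) q / algebraMap (RatFunc C)[X] (RatXY C) v) * H)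
    (hdeg : a.degree < b.degree) (hab : IsCoprime a b)
    (hbfree : ShiftFree b) (hbprime : StronglyPrime u v b)
    (hq : q ∈ standardComplement u v)
    (hbint : IntegerLinear (algebraMap (RatFunc C)[X] (RatXY C) b))
    (hTns : ¬ E.Summable T) :
    -- the maximum over the factors `p` is bounded by the order of every telescoper
    (∀ L : RecurrenceOperator C, E.IsTelescoper L T → 1 ≤ L.order) ∧
    ∀ (p : (RatFunc C)[X]) (α : ℕ), Irreducible p → p.Monic → 0 < p.natDegree → p ∣ b →
      emultiplicity p b = α →
      ∃ ρ : ℕ, IsLeast (shiftIndices b p α) ρ ∧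
        ∀ L : RecurrenceOperator C, E.IsTelescoper L T → ρ ≤ L.order := by
  refine ⟨fun L hL => hL.one_le_order hTns, fun p α hp _ hpdeg hpb hα => ?_⟩
  have hαb : p ^ α ∣ b := pow_dvd_of_le_emultiplicity hα.ge
  have hne := shiftIndices_nonempty hbint hp hpdeg hpb hαb
  refine ⟨sInf (shiftIndices b p α), ⟨Nat.sInf_mem hne, fun i hi => Nat.sInf_le hi⟩, fun L hL => ?_⟩
  obtain ⟨k, rfl⟩ : ∃ k, α = k + 1 := by
    refine Nat.exists_eq_succ_of_ne_zero ?_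
    rintro rfl
    exact (emultiplicity_ne_zero.2 hpb) (by simpa using hα)
  obtain ⟨N, hN0, hN, hNK⟩ := hH.exists_twistX hHK
  obtain ⟨G, hG, hLG⟩ := hL
  obtain ⟨r, hr⟩ : ∃ r, r =
      algebraMap (RatFunc C)[X] (RatXY C) a / algebraMap (RatFunc C)[X] (RatXY C) b +
        algebraMap (RatFunc C)[X] (RatXY C) q / algebraMap (RatFunc C)[X] (RatXY C) v := ⟨_, rfl⟩
  rw [← hr] at hred
  have hT' : T = E.incl (twistDelta K g + r) * H := by
    rw [hred, PartialDifferenceExtension.deltaY_incl_mul hHK, map_add, add_mul]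
  rw [hT', PartialDifferenceExtension.applyOp_incl_mul hN] at hLG
  obtain ⟨w, hw⟩ := PartialDifferenceExtension.IsHypergeometric.exists_twistDelta hH.1 hHK hG hLG
  -- Extension by zero lets the induction on the order reindex the coefficients freely.
  set e : ℕ → RatFunc C := fun i => if h : i < L.order + 1 then L.coeff ⟨i, h⟩ else 0 with he
  have hsum : ∑ i ∈ Finset.range (L.order + 1), RatFunc.C (e i) * (twistX N)^[i] r =
      twistDelta K (w - ∑ i ∈ Finset.range (L.order + 1), RatFunc.C (e i) * (twistX N)^[i] g) := by
    rw [twistDelta_sub, ← hw, ← twistDelta_sum, eq_sub_iff_add_eq, ← Finset.sum_add_distrib,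
      Finset.sum_range]
    refine Finset.sum_congr rfl fun i _ => ?_
    have hei : e i = L.coeff i := dif_pos i.isLt
    rw [hei, twistX_iterate_add, twistX_iterate_twistDelta hNK, ← C_mul_twistDelta, add_comm, mul_add]
  have hcoeff : ∃ i ≤ L.order, e i ≠ 0 := ⟨L.order, le_rfl, by
    simpa [he, Fin.last] using L.leading_ne_zero⟩
  obtain ⟨i, hi0, hiL, n, hn⟩ := exists_dvd_of_sum_eq_twistDelta hKred.1 hN0 hNK hv
    (isCoprime_polyShift_of_shiftReduced hKred hv huv hKuv) hKuv hbprime hbfree hab hp.prime hαb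
    L.order e _ hcoeff (hr ▸ hsum)
  have hmem : i ∈ shiftIndices b p (k + 1) := by
    -- Moving the shift from b to p inverts it, whence ℓ = -n.
    refine ⟨hi0, -n, ?_⟩
    rw [← map_pow]
    exact (dvd_polyShift_iff n _ _).1 hn
  exact (Nat.sInf_le hmem).trans hiL
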